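/- Let $\mathcal L$ be the twisted Heisenberg–Virasoro algebra (at level zero), i.e. the complex Lie algebra with basis $\{L_n, I_n, C_L, C_{LI}, C_I : n\in\mathbb Z\}$ and Lie bracket determined by $$[L_n,L_m]=(n-m)L_{n+m}+\delta_{n,-m}\frac{n^3-n}{12}C_L,\qquad [L_n,I_m]=-mI_{n+m}+\delta_{n,-m}(n^2+n)C_{LI},$$ $$[I_n,I_m]=n\,\delta_{n,-m}C_I,\qquad [\mathcal L,C_L]=[\mathcal L,C_{LI}]=[\mathcal L,C_I]=0 .$$ A derivation of $\mathcal L$ is a $\mathbb C$-linear map $D:\mathcal L\to\mathcal L$ with $D([x,y])=[D(x),y]+[x,D(y)]$ for all $x,y\in\mathcal L$. A map $\Delta:\mathcal L\to\mathcal L$, not assumed to be linear, is called a 2-local derivation if for every pair $x,y\in\mathcal L$ there is a derivation $\Delta_{x,y}$ of $\mathcal L$ (depending on $x,y$) such that $\Delta_{x,y}(x)=\Delta(x)$ and $\Delta_{x,y}(y)=\Delta(y)$. Theorem. Every 2-local derivation on $\mathcal L$ is a derivation. -/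

import Mathlib

namespace TwistedHeisenbergVirasoro

/-- The index set of the basis `{L_n, I_n, C_L, C_LI, C_I : n ∈ ℤ}`. -/
inductive Idx : Type
  | L (n : ℤ)
  | I (n : ℤ)
  | CL
  | CLI
  | CI

/-- The underlying complex vector space of the twisted Heisenberg-Virasoro algebra: finite formal
linear combinations of the basis elements. -/
def HV : Type := Idx →₀ ℂ

noncomputable instance : AddCommGroup HV := inferInstanceAs (AddCommGroup (Idx →₀ ℂ))

noncomputable instance : Module ℂ HV := inferInstanceAs (Module ℂ (Idx →₀ ℂ))

/-- The defining basis. -/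
noncomputable def basis : Module.Basis Idx ℂ HV := ⟨LinearEquiv.refl ℂ (Idx →₀ ℂ)⟩

/-- The basis elements `L_n`. -/
noncomputable def L (n : ℤ) : HV := basis (Idx.L n)

/-- The basis elements `I_n`. -/
noncomputable def I (n : ℤ) : HV := basis (Idx.I n)

/-- The central element `C_L`. -/
noncomputable def CL : HV := basis Idx.CL

/-- The central element `C_LI`. -/
noncomputable def CLI : HV := basis Idx.CLI

/-- The central element `C_I`. -/
noncomputable def CI : HV := basis Idx.CI

/-- The Kronecker delta `δ_{n,-m}`. -/
noncomputable def delta (n m : ℤ) : ℂ := if n = -m then 1 else 0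

/-- The commutation relations on the basis. -/
noncomputable def basisBracket : Idx → Idx → HV
  | Idx.L n, Idx.L m =>
      ((n : ℂ) - m) • L (n + m) + (delta n m * (((n : ℂ) ^ 3 - n) / 12)) • CL
  | Idx.L n, Idx.I m => (-(m : ℂ)) • I (n + m) + (delta n m * ((n : ℂ) ^ 2 + n)) • CLI
  | Idx.I m, Idx.L n => -((-(m : ℂ)) • I (n + m) + (delta n m * ((n : ℂ) ^ 2 + n)) • CLI)
  | Idx.I n, Idx.I m => ((n : ℂ) * delta n m) • CI
  | _, _ => 0

/-- The bilinear extension of the commutation relations. -/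
noncomputable def bracketHom : HV →ₗ[ℂ] HV →ₗ[ℂ] HV :=
  basis.constr ℂ fun i => basis.constr ℂ fun j => basisBracket i j

theorem bracketHom_basis (i j : Idx) : bracketHom (basis i) (basis j) = basisBracket i j := by
  simp [bracketHom, Module.Basis.constr_basis]

theorem bracketHom_L_L (n m : ℤ) : bracketHom (L n) (L m) =
    ((n : ℂ) - m) • L (n + m) + (delta n m * (((n : ℂ) ^ 3 - n) / 12)) • CL :=
  bracketHom_basis _ _

theorem bracketHom_L_I (n m : ℤ) : bracketHom (L n) (I m) =
    (-(m : ℂ)) • I (n + m) + (delta n m * ((n : ℂ) ^ 2 + n)) • CLI :=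
  bracketHom_basis _ _

theorem bracketHom_I_L (n m : ℤ) : bracketHom (I m) (L n) =
    -((-(m : ℂ)) • I (n + m) + (delta n m * ((n : ℂ) ^ 2 + n)) • CLI) :=
  bracketHom_basis _ _

theorem bracketHom_I_I (n m : ℤ) : bracketHom (I n) (I m) = ((n : ℂ) * delta n m) • CI :=
  bracketHom_basis _ _

theorem bracketHom_CL_right (x : HV) : bracketHom x CL = 0 := by
  have h : bracketHom.flip CL = 0 := by
    refine basis.ext fun i => ?_
    have := bracketHom_basis i Idx.CL
    cases i <;> exact this
  simpa using LinearMap.congr_fun h x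

theorem bracketHom_CLI_right (x : HV) : bracketHom x CLI = 0 := by
  have h : bracketHom.flip CLI = 0 := by
    refine basis.ext fun i => ?_
    have := bracketHom_basis i Idx.CLI
    cases i <;> exact this
  simpa using LinearMap.congr_fun h x

theorem bracketHom_CI_right (x : HV) : bracketHom x CI = 0 := by
  have h : bracketHom.flip CI = 0 := by
    refine basis.ext fun i => ?_
    have := bracketHom_basis i Idx.CI
    cases i <;> exact this
  simpa using LinearMap.congr_fun h x

theorem bracketHom_skew (x y : HV) : bracketHom x y = -bracketHom y x := by
  have h : bracketHom = -bracketHom.flip := by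
    refine basis.ext fun i => basis.ext fun j => ?_
    simp only [LinearMap.neg_apply, LinearMap.flip_apply, bracketHom_basis]
    cases i <;> cases j <;> simp only [basisBracket, neg_zero, neg_neg]
    · rename_i n m
      rw [add_comm m n]
      by_cases hnm : n = -m
      · subst hnm
        simp only [delta, neg_neg, if_true]
        push_cast
        module
      · have hmn : ¬ m = -n := fun hh => hnm (by omega)
        simp only [delta, if_neg hnm, if_neg hmn]
        module
    · rename_i n m
      by_cases hnm : n = -m
      · subst hnm
        simp only [delta, neg_neg, if_true]
        push_cast
        module
      · have hmn : ¬ m = -n := fun hh => hnm (by omega)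
        simp only [delta, if_neg hnm, if_neg hmn]
        module
  exact LinearMap.congr_fun (LinearMap.congr_fun h x) y

theorem bracketHom_CL_left (x : HV) : bracketHom CL x = 0 := by
  rw [bracketHom_skew, bracketHom_CL_right, neg_zero]

theorem bracketHom_CLI_left (x : HV) : bracketHom CLI x = 0 := by
  rw [bracketHom_skew, bracketHom_CLI_right, neg_zero]

theorem bracketHom_CI_left (x : HV) : bracketHom CI x = 0 := by
  rw [bracketHom_skew, bracketHom_CI_right, neg_zero]

theorem jacobi_LLL (n m k : ℤ) : bracketHom (L n) (bracketHom (L m) (L k)) =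
    bracketHom (bracketHom (L n) (L m)) (L k) + bracketHom (L m) (bracketHom (L n) (L k)) := by
  simp only [bracketHom_L_L, map_add, map_smul, LinearMap.add_apply, LinearMap.smul_apply,
    bracketHom_CL_right, bracketHom_CL_left, smul_zero, add_zero]
  rw [show n + m + k = n + (m + k) by ring, show m + (n + k) = n + (m + k) by ring]
  by_cases h : n + m + k = 0
  · obtain rfl : k = -n - m := by omega
    simp only [delta, if_pos (show n = -(m + (-n - m)) by ring),
      if_pos (show n + m = -(-n - m) by ring), if_pos (show m = -(n + (-n - m)) by ring)]
    push_cast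
    module
  · simp only [delta, if_neg (show ¬ n = -(m + k) by omega),
      if_neg (show ¬ n + m = -k by omega), if_neg (show ¬ m = -(n + k) by omega)]
    push_cast
    module

theorem jacobi_LLI (n m k : ℤ) : bracketHom (L n) (bracketHom (L m) (I k)) =
    bracketHom (bracketHom (L n) (L m)) (I k) + bracketHom (L m) (bracketHom (L n) (I k)) := by
  simp only [bracketHom_L_L, bracketHom_L_I, map_add, map_smul, LinearMap.add_apply,
    LinearMap.smul_apply, bracketHom_CL_left, bracketHom_CLI_right, smul_zero, add_zero]
  rw [show n + m + k = n + (m + k) by ring, show m + (n + k) = n + (m + k) by ring]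
  by_cases h : n + m + k = 0
  · obtain rfl : k = -n - m := by omega
    simp only [delta, if_pos (show n = -(m + (-n - m)) by ring),
      if_pos (show n + m = -(-n - m) by ring), if_pos (show m = -(n + (-n - m)) by ring)]
    push_cast
    module
  · simp only [delta, if_neg (show ¬ n = -(m + k) by omega),
      if_neg (show ¬ n + m = -k by omega), if_neg (show ¬ m = -(n + k) by omega)]
    push_cast
    module

theorem jacobi_LII (n m k : ℤ) : bracketHom (L n) (bracketHom (I m) (I k)) =
    bracketHom (bracketHom (L n) (I m)) (I k) + bracketHom (I m) (bracketHom (L n) (I k)) := by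
  simp only [bracketHom_I_I, bracketHom_L_I, map_add, map_smul, LinearMap.add_apply,
    LinearMap.smul_apply, bracketHom_CI_right, bracketHom_CLI_right, bracketHom_CLI_left,
    smul_zero, add_zero]
  by_cases h : n + m + k = 0
  · obtain rfl : k = -n - m := by omega
    simp only [delta, if_pos (show n + m = -(-n - m) by ring),
      if_pos (show m = -(n + (-n - m)) by ring)]
    push_cast
    module
  · simp only [delta, if_neg (show ¬ n + m = -k by omega),
      if_neg (show ¬ m = -(n + k) by omega)]
    module

theorem jacobi_III (n m k : ℤ) : bracketHom (I n) (bracketHom (I m) (I k)) =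
    bracketHom (bracketHom (I n) (I m)) (I k) + bracketHom (I m) (bracketHom (I n) (I k)) := by
  simp only [bracketHom_I_I, map_smul, LinearMap.smul_apply, bracketHom_CI_right,
    bracketHom_CI_left, smul_zero, add_zero]

theorem leibniz_swap {x y z : HV}
    (h : bracketHom x (bracketHom y z) =
      bracketHom (bracketHom x y) z + bracketHom y (bracketHom x z)) :
    bracketHom y (bracketHom x z) =
      bracketHom (bracketHom y x) z + bracketHom x (bracketHom y z) := by
  rw [h, bracketHom_skew y x, map_neg, LinearMap.neg_apply]
  abel

theorem leibniz_rot {x y z : HV}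
    (h : bracketHom x (bracketHom y z) =
      bracketHom (bracketHom x y) z + bracketHom y (bracketHom x z)) :
    bracketHom y (bracketHom z x) =
      bracketHom (bracketHom y z) x + bracketHom z (bracketHom y x) := by
  rw [bracketHom_skew z x, bracketHom_skew (bracketHom y z) x, bracketHom_skew y x, map_neg,
    map_neg, h, bracketHom_skew (bracketHom x y) z]
  abel

theorem bracketHom_leibniz (x y z : HV) : bracketHom x (bracketHom y z) =
    bracketHom (bracketHom x y) z + bracketHom y (bracketHom x z) := by
  have key : ∀ i j k : Idx, bracketHom (basis i) (bracketHom (basis j) (basis k)) =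
      bracketHom (bracketHom (basis i) (basis j)) (basis k) +
        bracketHom (basis j) (bracketHom (basis i) (basis k)) := by
    intro i j k
    have eL : ∀ n, basis (Idx.L n) = L n := fun _ => rfl
    have eI : ∀ n, basis (Idx.I n) = I n := fun _ => rfl
    have eCL : basis Idx.CL = CL := rfl
    have eCLI : basis Idx.CLI = CLI := rfl
    have eCI : basis Idx.CI = CI := rfl
    cases i <;> cases j <;> cases k <;>
      simp only [eL, eI, eCL, eCLI, eCI, bracketHom_CL_right, bracketHom_CLI_right,
        bracketHom_CI_right, bracketHom_CL_left, bracketHom_CLI_left, bracketHom_CI_left,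
        map_zero, LinearMap.zero_apply, add_zero]
    · exact jacobi_LLL _ _ _
    · exact jacobi_LLI _ _ _
    · exact leibniz_swap (leibniz_rot (leibniz_rot (leibniz_swap (jacobi_LLI _ _ _))))
    · exact jacobi_LII _ _ _
    · exact leibniz_rot (leibniz_rot (jacobi_LLI _ _ _))
    · exact leibniz_swap (jacobi_LII _ _ _)
    · exact leibniz_rot (jacobi_LII _ _ _)
    · exact jacobi_III _ _ _
  have hx : ∀ j k : Idx, ∀ x : HV, bracketHom x (bracketHom (basis j) (basis k)) =
      bracketHom (bracketHom x (basis j)) (basis k) +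
        bracketHom (basis j) (bracketHom x (basis k)) := by
    intro j k
    have h : bracketHom.flip (bracketHom (basis j) (basis k)) =
        bracketHom.flip (basis k) ∘ₗ bracketHom.flip (basis j) +
          bracketHom (basis j) ∘ₗ bracketHom.flip (basis k) :=
      basis.ext fun i => by simpa using key i j k
    exact fun x => by simpa using LinearMap.congr_fun h x
  have hy : ∀ k : Idx, ∀ y : HV, bracketHom x (bracketHom y (basis k)) =
      bracketHom (bracketHom x y) (basis k) + bracketHom y (bracketHom x (basis k)) := by
    intro k
    have h : bracketHom x ∘ₗ bracketHom.flip (basis k) =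
        bracketHom.flip (basis k) ∘ₗ bracketHom x +
          bracketHom.flip (bracketHom x (basis k)) :=
      basis.ext fun j => by simpa using hx j k x
    exact fun y => by simpa using LinearMap.congr_fun h y
  have hz : bracketHom x ∘ₗ bracketHom y =
      bracketHom (bracketHom x y) + bracketHom y ∘ₗ bracketHom x :=
    basis.ext fun k => by simpa using hy k y
  simpa using LinearMap.congr_fun hz z

noncomputable instance : LieRing HV where
  bracket x y := bracketHom x y
  add_lie x y z := by simp
  lie_add x y z := by simp
  lie_self x := by
    have h : (2 : ℂ) • bracketHom x x = 0 := by
      rw [two_smul]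
      nth_rewrite 1 [bracketHom_skew x x]
      exact neg_add_cancel _
    exact (smul_eq_zero.mp h).resolve_left two_ne_zero
  leibniz_lie := bracketHom_leibniz

noncomputable instance : LieAlgebra ℂ HV where
  toModule := inferInstance
  lie_smul t x y := map_smul (bracketHom x) t y

theorem lie_L_L (n m : ℤ) :
    ⁅L n, L m⁆ = ((n : ℂ) - m) • L (n + m) + (delta n m * (((n : ℂ) ^ 3 - n) / 12)) • CL :=
  bracketHom_L_L n m

theorem lie_L_I (n m : ℤ) :
    ⁅L n, I m⁆ = (-(m : ℂ)) • I (n + m) + (delta n m * ((n : ℂ) ^ 2 + n)) • CLI :=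
  bracketHom_L_I n m

theorem lie_I_I (n m : ℤ) : ⁅I n, I m⁆ = ((n : ℂ) * delta n m) • CI :=
  bracketHom_I_I n m

theorem lie_CL (x : HV) : ⁅x, CL⁆ = 0 := bracketHom_CL_right x

theorem lie_CLI (x : HV) : ⁅x, CLI⁆ = 0 := bracketHom_CLI_right x

theorem lie_CI (x : HV) : ⁅x, CI⁆ = 0 := bracketHom_CI_right x

/-- A map `Δ` of a Lie algebra into itself, not assumed linear, is a 2-local derivation if on
every pair of elements it agrees with some derivation, which may depend on the pair. -/
def IsTwoLocalDerivation (R : Type*) {g : Type*} [CommRing R] [LieRing g] [LieAlgebra R g]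
    (Δ : g → g) : Prop :=
  ∀ x y : g, ∃ D : LieDerivation R g g, D x = Δ x ∧ D y = Δ y

end TwistedHeisenbergVirasoro

namespace TwistedHeisenbergVirasoro

/-! The derivations killing the single vector `marked k` are exactly the multiples of `ad (L k)`, a
one-dimensional space (`exists_eq_smul_lie_of_apply_marked`). This rests on the classification of
derivations modulo inner ones (`exists_inner_apply_eq`): what remains is `L n ↦ (a * n + b) • I n`,
`I n ↦ q • I n` for `n ≠ 0`, and these values determine the derivation. The summands `CL` and `CI`
of `marked k` detect `a` and `q`.

Given a 2-local derivation, subtract a derivation agreeing with it at `marked 0` and `marked 1`. The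
difference sends each `x` into both `ℂ ⁅L 0, x⁆` and `ℂ ⁅L 1, x⁆`. For `x = marked k` these lines
meet in zero, so every `marked k` is killed, and the value at `x` lies in `ℂ ⁅L k, x⁆` for all `k`.
Since `ad (L k)` shifts degrees by `k`, a large shift moves the finite support of `x` off itself,
and the value is zero (`eq_zero_of_forall_exists_smul_lie`). -/

theorem coord_L_L (m n : ℤ) : basis.coord (Idx.L m) (L n) = if n = m then 1 else 0 := by
  classical simp [L, Finsupp.single_apply]

theorem coord_L_I (m n : ℤ) : basis.coord (Idx.L m) (I n) = 0 := by
  simp [I]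

theorem coord_L_CL (m : ℤ) : basis.coord (Idx.L m) CL = 0 := by
  simp [CL]

theorem coord_L_CLI (m : ℤ) : basis.coord (Idx.L m) CLI = 0 := by
  simp [CLI]

theorem coord_L_CI (m : ℤ) : basis.coord (Idx.L m) CI = 0 := by
  simp [CI]

theorem coord_I_L (m n : ℤ) : basis.coord (Idx.I m) (L n) = 0 := by
  simp [L]

theorem coord_I_I (m n : ℤ) : basis.coord (Idx.I m) (I n) = if n = m then 1 else 0 := by
  classical simp [I, Finsupp.single_apply]

theorem coord_I_CL (m : ℤ) : basis.coord (Idx.I m) CL = 0 := by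
  simp [CL]

theorem coord_I_CLI (m : ℤ) : basis.coord (Idx.I m) CLI = 0 := by
  simp [CLI]

theorem coord_I_CI (m : ℤ) : basis.coord (Idx.I m) CI = 0 := by
  simp [CI]

theorem coord_CL_L (n : ℤ) : basis.coord Idx.CL (L n) = 0 := by
  simp [L]

theorem coord_CL_I (n : ℤ) : basis.coord Idx.CL (I n) = 0 := by
  simp [I]

theorem coord_CL_CL : basis.coord Idx.CL CL = 1 := by
  simp [CL]

theorem coord_CL_CLI : basis.coord Idx.CL CLI = 0 := by
  simp [CLI]

theorem coord_CL_CI : basis.coord Idx.CL CI = 0 := by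
  simp [CI]

theorem coord_CLI_L (n : ℤ) : basis.coord Idx.CLI (L n) = 0 := by
  simp [L]

theorem coord_CLI_I (n : ℤ) : basis.coord Idx.CLI (I n) = 0 := by
  simp [I]

theorem coord_CLI_CL : basis.coord Idx.CLI CL = 0 := by
  simp [CL]

theorem coord_CLI_CLI : basis.coord Idx.CLI CLI = 1 := by
  simp [CLI]

theorem coord_CLI_CI : basis.coord Idx.CLI CI = 0 := by
  simp [CI]

theorem coord_CI_L (n : ℤ) : basis.coord Idx.CI (L n) = 0 := by
  simp [L]

theorem coord_CI_I (n : ℤ) : basis.coord Idx.CI (I n) = 0 := by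
  simp [I]

theorem coord_CI_CL : basis.coord Idx.CI CL = 0 := by
  simp [CL]

theorem coord_CI_CLI : basis.coord Idx.CI CLI = 0 := by
  simp [CLI]

theorem coord_CI_CI : basis.coord Idx.CI CI = 1 := by
  simp [CI]

attribute [simp] coord_L_L coord_L_I coord_L_CL coord_L_CLI coord_L_CI coord_I_L coord_I_I
  coord_I_CL coord_I_CLI coord_I_CI coord_CL_L coord_CL_I coord_CL_CL coord_CL_CLI coord_CL_CI
  coord_CLI_L coord_CLI_I coord_CLI_CL coord_CLI_CLI coord_CLI_CI coord_CI_L coord_CI_I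
  coord_CI_CL coord_CI_CLI coord_CI_CI

attribute [-simp] Module.Basis.coord_apply

attribute [simp] lie_CL lie_CLI lie_CI

theorem lie_I_L (n m : ℤ) :
    ⁅I m, L n⁆ = (m : ℂ) • I (n + m) - (delta n m * ((n : ℂ) ^ 2 + n)) • CLI := by
  rw [← lie_skew, lie_L_I]; module

theorem CL_lie (x : HV) : ⁅CL, x⁆ = 0 := by rw [← lie_skew, lie_CL, neg_zero]

theorem CLI_lie (x : HV) : ⁅CLI, x⁆ = 0 := by rw [← lie_skew, lie_CLI, neg_zero]

theorem CI_lie (x : HV) : ⁅CI, x⁆ = 0 := by rw [← lie_skew, lie_CI, neg_zero]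

attribute [simp] CL_lie CLI_lie CI_lie

/-- A linear map out of the algebra is determined by its values on the generators. -/
theorem hom_ext {M : Type*} [AddCommGroup M] [Module ℂ M] {f g : HV →ₗ[ℂ] M}
    (hL : ∀ n, f (L n) = g (L n)) (hI : ∀ n, f (I n) = g (I n)) (hCL : f CL = g CL)
    (hCLI : f CLI = g CLI) (hCI : f CI = g CI) : f = g := by
  refine basis.ext fun i => ?_
  cases i
  exacts [hL _, hI _, hCL, hCLI, hCI]

theorem ext_coord {x y : HV} (h : ∀ i, basis.coord i x = basis.coord i y) : x = y :=
  basis.ext_elem h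


/-! ### Coordinates of `ad (L n)` and `ad (I n)`. -/

theorem coord_L_lie_L (n m : ℤ) (x : HV) : basis.coord (Idx.L m) ⁅L n, x⁆ =
    (2 * n - m) * basis.coord (Idx.L (m - n)) x := by
  have : basis.coord (Idx.L m) ∘ₗ LieAlgebra.ad ℂ HV (L n) =
      (2 * n - m : ℂ) • basis.coord (Idx.L (m - n)) := by
    apply hom_ext
    · intro k
      rcases eq_or_ne m (n + k) with rfl | h
      · simp [lie_L_L]; ring
      · simp [lie_L_L, h.symm, show k ≠ m - n by omega]
    all_goals simp [lie_L_I]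
  exact LinearMap.congr_fun this x

theorem coord_I_lie_L (n m : ℤ) (x : HV) : basis.coord (Idx.I m) ⁅L n, x⁆ =
    (n - m) * basis.coord (Idx.I (m - n)) x := by
  have : basis.coord (Idx.I m) ∘ₗ LieAlgebra.ad ℂ HV (L n) =
      (n - m : ℂ) • basis.coord (Idx.I (m - n)) := by
    apply hom_ext
    · simp [lie_L_L]
    · intro k
      rcases eq_or_ne m (n + k) with rfl | h
      · simp [lie_L_I]
      · simp [lie_L_I, h.symm, show k ≠ m - n by omega]
    all_goals simp
  exact LinearMap.congr_fun this x

theorem coord_CL_lie_L (n : ℤ) (x : HV) : basis.coord Idx.CL ⁅L n, x⁆ =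
    ((n : ℂ) ^ 3 - n) / 12 * basis.coord (Idx.L (-n)) x := by
  have : basis.coord Idx.CL ∘ₗ LieAlgebra.ad ℂ HV (L n) =
      (((n : ℂ) ^ 3 - n) / 12) • basis.coord (Idx.L (-n)) := by
    apply hom_ext
    · intro k
      rcases eq_or_ne k (-n) with rfl | h
      · simp [lie_L_L, delta]
      · simp [lie_L_L, delta, h, show n ≠ -k by omega]
    all_goals simp [lie_L_I]
  exact LinearMap.congr_fun this x

theorem coord_CLI_lie_L (n : ℤ) (x : HV) : basis.coord Idx.CLI ⁅L n, x⁆ =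
    ((n : ℂ) ^ 2 + n) * basis.coord (Idx.I (-n)) x := by
  have : basis.coord Idx.CLI ∘ₗ LieAlgebra.ad ℂ HV (L n) =
      ((n : ℂ) ^ 2 + n) • basis.coord (Idx.I (-n)) := by
    apply hom_ext
    · simp [lie_L_L]
    · intro k
      rcases eq_or_ne k (-n) with rfl | h
      · simp [lie_L_I, delta]
      · simp [lie_L_I, delta, h, show n ≠ -k by omega]
    all_goals simp
  exact LinearMap.congr_fun this x

theorem coord_CI_lie_L (n : ℤ) (x : HV) : basis.coord Idx.CI ⁅L n, x⁆ = 0 := by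
  have : basis.coord Idx.CI ∘ₗ LieAlgebra.ad ℂ HV (L n) = 0 := by
    apply hom_ext <;> simp [lie_L_L, lie_L_I]
  exact LinearMap.congr_fun this x

theorem coord_L_lie_I (n m : ℤ) (x : HV) : basis.coord (Idx.L m) ⁅I n, x⁆ = 0 := by
  have : basis.coord (Idx.L m) ∘ₗ LieAlgebra.ad ℂ HV (I n) = 0 := by
    apply hom_ext <;> simp [lie_I_L, lie_I_I]
  exact LinearMap.congr_fun this x

theorem coord_I_lie_I (n m : ℤ) (x : HV) : basis.coord (Idx.I m) ⁅I n, x⁆ =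
    n * basis.coord (Idx.L (m - n)) x := by
  have : basis.coord (Idx.I m) ∘ₗ LieAlgebra.ad ℂ HV (I n) =
      (n : ℂ) • basis.coord (Idx.L (m - n)) := by
    apply hom_ext
    · intro k
      rcases eq_or_ne m (k + n) with rfl | h
      · simp [lie_I_L]
      · simp [lie_I_L, h.symm, show k ≠ m - n by omega]
    all_goals simp [lie_I_I]
  exact LinearMap.congr_fun this x

theorem coord_CL_lie_I (n : ℤ) (x : HV) : basis.coord Idx.CL ⁅I n, x⁆ = 0 := by
  have : basis.coord Idx.CL ∘ₗ LieAlgebra.ad ℂ HV (I n) = 0 := by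
    apply hom_ext <;> simp [lie_I_L, lie_I_I]
  exact LinearMap.congr_fun this x

theorem coord_CLI_lie_I (n : ℤ) (x : HV) : basis.coord Idx.CLI ⁅I n, x⁆ =
    (n - (n : ℂ) ^ 2) * basis.coord (Idx.L (-n)) x := by
  have : basis.coord Idx.CLI ∘ₗ LieAlgebra.ad ℂ HV (I n) =
      (n - (n : ℂ) ^ 2) • basis.coord (Idx.L (-n)) := by
    apply hom_ext
    · intro k
      rcases eq_or_ne k (-n) with rfl | h
      · simp [lie_I_L, delta]; ring
      · simp [lie_I_L, delta, h]
    all_goals simp [lie_I_I]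
  exact LinearMap.congr_fun this x

theorem coord_CI_lie_I (n : ℤ) (x : HV) : basis.coord Idx.CI ⁅I n, x⁆ =
    n * basis.coord (Idx.I (-n)) x := by
  have : basis.coord Idx.CI ∘ₗ LieAlgebra.ad ℂ HV (I n) =
      (n : ℂ) • basis.coord (Idx.I (-n)) := by
    apply hom_ext
    · simp [lie_I_L]
    · intro k
      rcases eq_or_ne k (-n) with rfl | h
      · simp [lie_I_I, delta]
      · simp [lie_I_I, delta, h, show n ≠ -k by omega]
    all_goals simp
  exact LinearMap.congr_fun this x

/-! ### Reduction to derivations of degree zero. -/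

/-- Every derivation differs by an inner one from a derivation sending `L_0` into degree zero. -/
theorem exists_inner_coord_eq_zero (D : LieDerivation ℂ HV HV) : ∃ u : HV, ∀ m : ℤ, m ≠ 0 →
    basis.coord (Idx.L m) ((D + LieDerivation.inner ℂ HV HV u) (L 0)) = 0 ∧
      basis.coord (Idx.I m) ((D + LieDerivation.inner ℂ HV HV u) (L 0)) = 0 := by
  -- `ad (L 0)` acts by `-n` in degree `n`, so `T` is minus its inverse on nonzero degrees; in
  -- degree zero `0⁻¹ = 0` makes it vanish.
  let T : HV →ₗ[ℂ] HV := basis.constr ℂ fun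
    | Idx.L n => (n : ℂ)⁻¹ • L n
    | Idx.I n => (n : ℂ)⁻¹ • I n
    | _ => 0
  have TL (n : ℤ) : T (L n) = (n : ℂ)⁻¹ • L n := Module.Basis.constr_basis _ _ _ _
  have TI (n : ℤ) : T (I n) = (n : ℂ)⁻¹ • I n := Module.Basis.constr_basis _ _ _ _
  have TCL : T CL = 0 := Module.Basis.constr_basis _ _ _ _
  have TCLI : T CLI = 0 := Module.Basis.constr_basis _ _ _ _
  have TCI : T CI = 0 := Module.Basis.constr_basis _ _ _ _
  have hL (m : ℤ) (x : HV) :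
      basis.coord (Idx.L m) (T x) = (m : ℂ)⁻¹ * basis.coord (Idx.L m) x := by
    have : basis.coord (Idx.L m) ∘ₗ T = (m : ℂ)⁻¹ • basis.coord (Idx.L m) := by
      apply hom_ext <;> simp +contextual [TL, TI, TCL, TCLI, TCI]
    exact LinearMap.congr_fun this x
  have hI (m : ℤ) (x : HV) :
      basis.coord (Idx.I m) (T x) = (m : ℂ)⁻¹ * basis.coord (Idx.I m) x := by
    have : basis.coord (Idx.I m) ∘ₗ T = (m : ℂ)⁻¹ • basis.coord (Idx.I m) := by
      apply hom_ext <;> simp +contextual [TL, TI, TCL, TCLI, TCI]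
    exact LinearMap.congr_fun this x
  refine ⟨T (D (L 0)), fun m hm => ?_⟩
  have hm' : (m : ℂ) ≠ 0 := by exact_mod_cast hm
  simp [coord_L_lie_L, coord_I_lie_L, hL, hI, hm']

section DegreeZero

variable {E : LieDerivation ℂ HV HV}

theorem coord_L_apply_L_zero
    (hE : ∀ m : ℤ, m ≠ 0 → basis.coord (Idx.L m) (E (L 0)) = 0 ∧
      basis.coord (Idx.I m) (E (L 0)) = 0) (n : ℤ) :
    basis.coord (Idx.L n) (E (L 0)) = 0 := by
  rcases eq_or_ne n 0 with rfl | hn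
  · have h := congrArg (basis.coord (Idx.L 1)) (E.apply_lie_eq_sub (L 0) (L 1))
    simp [lie_L_L, coord_L_lie_L] at h
    linear_combination h
  · exact (hE n hn).1

/-- Apply `E` to `⁅L 0, L n⁆ = -n • L n`: as `E (L 0)` brackets trivially, `E (L n)` is an
eigenvector of `ad (L 0)` for `-n`. For `n ≠ 0` this also excludes the central coordinates. -/
theorem apply_L_of_ne_zero
    (hE : ∀ m : ℤ, m ≠ 0 → basis.coord (Idx.L m) (E (L 0)) = 0 ∧
      basis.coord (Idx.I m) (E (L 0)) = 0) {n : ℤ} (hn : n ≠ 0) :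
    E (L n) = basis.coord (Idx.L n) (E (L n)) • L n +
      basis.coord (Idx.I n) (E (L n)) • I n := by
  have hn' : (n : ℂ) ≠ 0 := by exact_mod_cast hn
  have h (i : Idx) := congrArg (basis.coord i) (E.apply_lie_eq_sub (L 0) (L n))
  have h0 := coord_L_apply_L_zero hE
  refine ext_coord fun i => ?_
  specialize h i
  cases i with
  | L m =>
    rcases eq_or_ne n m with rfl | hm
    · simp
    · simp [lie_L_L, coord_L_lie_L, h0] at h
      simp [hm, h.resolve_left hm]
  | I m =>
    rcases eq_or_ne n m with rfl | hm
    · simp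
    · simp [lie_L_L, coord_I_lie_L, (hE (m - n) (sub_ne_zero.2 hm.symm)).2] at h
      simp [hm, h.resolve_left hm]
  | CL => simpa [lie_L_L, coord_CL_lie_L, h0, hn'] using h
  | CLI => simpa [lie_L_L, coord_CLI_lie_L, (hE (-n) (neg_ne_zero.2 hn)).2, hn'] using h
  | CI => simpa [lie_L_L, coord_CI_lie_L, hn'] using h

theorem apply_I_of_ne_zero
    (hE : ∀ m : ℤ, m ≠ 0 → basis.coord (Idx.L m) (E (L 0)) = 0 ∧
      basis.coord (Idx.I m) (E (L 0)) = 0) {n : ℤ} (hn : n ≠ 0) :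
    E (I n) = basis.coord (Idx.L n) (E (I n)) • L n +
      basis.coord (Idx.I n) (E (I n)) • I n := by
  have hn' : (n : ℂ) ≠ 0 := by exact_mod_cast hn
  have h (i : Idx) := congrArg (basis.coord i) (E.apply_lie_eq_sub (L 0) (I n))
  have h0 := coord_L_apply_L_zero hE
  refine ext_coord fun i => ?_
  specialize h i
  cases i with
  | L m =>
    rcases eq_or_ne n m with rfl | hm
    · simp
    · simp [lie_L_I, coord_L_lie_L, coord_L_lie_I] at h
      simp [hm, h.resolve_left hm]
  | I m =>
    rcases eq_or_ne n m with rfl | hm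
    · simp
    · simp [lie_L_I, coord_I_lie_L, coord_I_lie_I, h0] at h
      simp [hm, h.resolve_left hm]
  | CL => simpa [lie_L_I, coord_CL_lie_L, coord_CL_lie_I, hn'] using h
  | CLI => simpa [lie_L_I, coord_CLI_lie_L, coord_CLI_lie_I, h0, hn'] using h
  | CI =>
    simpa [lie_L_I, coord_CI_lie_L, coord_CI_lie_I, (hE (-n) (neg_ne_zero.2 hn)).2, hn'] using h

end DegreeZero

/-! ### Recurrences for the diagonal coefficients. -/

theorem eq_mul_of_shift_eq {f : ℤ → ℂ} (h0 : f 0 = 0)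
    (h : ∀ n : ℤ, (1 - n : ℂ) * f (1 + n) = (1 - n) * (f n + f 1))
    (h' : ∀ n : ℤ, (-1 - n : ℂ) * f (-1 + n) = (-1 - n) * (f n + f (-1))) (n : ℤ) :
    f n = n * f 1 := by
  have hneg : f (-1) = -f 1 := by
    have := h (-1)
    norm_num [h0] at this
    linear_combination this
  have step (n : ℤ) : f (1 + n) = f n + f 1 := by
    rcases eq_or_ne n 1 with rfl | hn
    -- At `n = 1` the relation `h` reads `0 = 0`; `h'` at `2` supplies `f 2` instead.
    · have := h' 2
      norm_num [hneg] at this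
      norm_num
      linear_combination -this
    · exact mul_left_cancel₀ (by exact_mod_cast sub_ne_zero.2 hn.symm) (h n)
  induction n with
  | zero => simp [h0]
  | succ n ih => rw [add_comm, step, ih]; push_cast; ring
  | pred n ih =>
    have := step (-n - 1)
    rw [add_sub_cancel, ih] at this
    push_cast at this ⊢
    linear_combination -this

theorem eq_zero_of_shift_eq {g : ℤ → ℂ} (h0 : g 0 = 0) (h1 : g 1 = 0)
    (h : ∀ n : ℤ, (1 - n : ℂ) * g (1 + n) = g 1 - n * g n)
    (h' : ∀ n : ℤ, (-1 - n : ℂ) * g (-1 + n) = -g (-1) - n * g n) (n : ℤ) : g n = 0 := by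
  have hm1 : g (-1) = 0 := by
    have := h (-1)
    norm_num [h0, h1] at this
    exact this.symm
  have h2 : g 2 = 0 := by
    have := h' 2
    norm_num [h1, hm1] at this
    exact this
  have pos (n : ℕ) : g (n + 2) = 0 := by
    induction n with
    | zero => simpa using h2
    | succ n ih =>
      have := h (n + 2)
      rw [ih, h1] at this
      have hne : (1 - ((n + 2 : ℤ) : ℂ)) ≠ 0 := by
        exact_mod_cast (by omega : (1 : ℤ) - (n + 2) ≠ 0)
      rw [mul_zero, sub_zero, mul_eq_zero] at this
      rw [← this.resolve_left hne]
      congr 1; push_cast; ring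
  have neg (n : ℕ) : g (-n) = 0 := by
    induction n with
    | zero => simpa using h0
    | succ n ih =>
      have := h (-(n + 1))
      rw [show (1 : ℤ) + -(n + 1) = -n by ring, ih, h1] at this
      have hne : ((-(n + 1) : ℤ) : ℂ) ≠ 0 := by
        exact_mod_cast (by omega : (-(n + 1) : ℤ) ≠ 0)
      rw [mul_zero, zero_sub, eq_comm, neg_eq_zero, mul_eq_zero] at this
      exact_mod_cast this.resolve_left hne
  rcases le_or_gt n 0 with hn | hn
  · simpa [abs_of_nonpos hn] using neg n.natAbs
  · rcases eq_or_ne n 1 with rfl | hn'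
    · exact h1
    · obtain ⟨k, hk⟩ := Int.eq_ofNat_of_zero_le (show 0 ≤ n - 2 by omega)
      rw [show n = k + 2 by omega]
      exact pos k

/-- Affine functions solve both recurrences, so subtracting the one matching `g` at `0` and `1`
reduces to `eq_zero_of_shift_eq`. -/
theorem eq_affine_of_shift_eq {g : ℤ → ℂ}
    (h : ∀ n : ℤ, (1 - n : ℂ) * g (1 + n) = g 1 - n * g n)
    (h' : ∀ n : ℤ, (-1 - n : ℂ) * g (-1 + n) = -g (-1) - n * g n) (n : ℤ) :
    g n = (g 1 - g 0) * n + g 0 := by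
  have := eq_zero_of_shift_eq (g := fun n => g n - ((g 1 - g 0) * n + g 0)) (by simp) (by simp)
    (fun n => by push_cast; linear_combination h n)
    (fun n => by push_cast; linear_combination h' n) n
  exact sub_eq_zero.1 this

/-- Taking `n = -2 * m` gives `p (-m) = 3 * p m`; used twice, `p m = 9 * p m`. -/
theorem eq_zero_of_weighted_shift_eq {p : ℤ → ℂ}
    (h : ∀ n m : ℤ, n + m ≠ 0 → -(m : ℂ) * p (n + m) = (n - m) * p m) {m : ℤ} (hm : m ≠ 0) :
    p m = 0 := by
  have key {k : ℤ} (hk : k ≠ 0) : p (-k) = 3 * p k := by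
    have := h (-2 * k) k (by omega)
    rw [show -2 * k + k = -k by ring] at this
    push_cast at this
    refine mul_left_cancel₀ (Int.cast_ne_zero.2 hk : (k : ℂ) ≠ 0) ?_
    linear_combination -this
  have h1 := key hm
  have h2 := key (neg_ne_zero.2 hm)
  rw [neg_neg] at h2
  linear_combination -h2 / 8 - 3 / 8 * h1

/-! ### Classification of derivations modulo inner ones. -/

/-- Modulo inner derivations, every derivation is diagonal of the following form on the
`L_n` and `I_n` with `n ≠ 0`. -/
theorem exists_inner_apply_eq (D : LieDerivation ℂ HV HV) : ∃ (u : HV) (a b q : ℂ),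
    ∀ n : ℤ, n ≠ 0 → (D + LieDerivation.inner ℂ HV HV u) (L n) = (a * n + b) • I n ∧
      (D + LieDerivation.inner ℂ HV HV u) (I n) = q • I n := by
  obtain ⟨v, hv⟩ := exists_inner_coord_eq_zero D
  -- Since `⁅L 1, L 0⁆ = L 1`, the multiple of `L 0` cancels the `L 1` coordinate at `L 1` without
  -- changing the value at `L 0`.
  let u := v - basis.coord (Idx.L 1) ((D + LieDerivation.inner ℂ HV HV v) (L 1)) • L 0
  obtain ⟨E, hE'⟩ : ∃ E, E = D + LieDerivation.inner ℂ HV HV u := ⟨_, rfl⟩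
  have hE : ∀ m : ℤ, m ≠ 0 → basis.coord (Idx.L m) (E (L 0)) = 0 ∧
      basis.coord (Idx.I m) (E (L 0)) = 0 := by
    simpa [hE', u] using hv
  have f1 : basis.coord (Idx.L 1) (E (L 1)) = 0 := by
    simp [hE', u, lie_L_L]
  -- The condition removes the `CL` term; it is used for `n = 1` and `n = -1`.
  have hLL (n m : ℤ) (hnm : (n : ℂ) ^ 3 - n = 0) (i : Idx) :
      (n - m : ℂ) * basis.coord i (E (L (n + m))) =
        basis.coord i ⁅L n, E (L m)⁆ - basis.coord i ⁅L m, E (L n)⁆ := by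
    simpa [lie_L_L, hnm] using congrArg (basis.coord i) (E.apply_lie_eq_sub (L n) (L m))
  have hLI (n m : ℤ) (hnm : n + m ≠ 0) (i : Idx) :
      -(m : ℂ) * basis.coord i (E (I (n + m))) =
        basis.coord i ⁅L n, E (I m)⁆ - basis.coord i ⁅I m, E (L n)⁆ := by
    simpa [lie_L_I, delta, show n ≠ -m by omega] using
      congrArg (basis.coord i) (E.apply_lie_eq_sub (L n) (I m))
  have hf (n : ℤ) : basis.coord (Idx.L n) (E (L n)) = 0 := by
    have := eq_mul_of_shift_eq (f := fun n => basis.coord (Idx.L n) (E (L n)))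
      (coord_L_apply_L_zero hE 0)
      (fun n => by
        have := hLL 1 n (by simp) (Idx.L (1 + n))
        simp only [coord_L_lie_L, add_sub_cancel_left, add_sub_cancel_right] at this
        push_cast at this
        linear_combination this)
      (fun n => by
        have := hLL (-1) n (by norm_num) (Idx.L (-1 + n))
        simp only [coord_L_lie_L, add_sub_cancel_left, add_sub_cancel_right] at this
        push_cast at this
        linear_combination this) n
    simpa [f1] using this
  have hg := eq_affine_of_shift_eq (g := fun n => basis.coord (Idx.I n) (E (L n)))
    (fun n => by
      have := hLL 1 n (by simp) (Idx.I (1 + n))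
      simp only [coord_I_lie_L, add_sub_cancel_left, add_sub_cancel_right] at this
      push_cast at this
      linear_combination this)
    (fun n => by
      have := hLL (-1) n (by norm_num) (Idx.I (-1 + n))
      simp only [coord_I_lie_L, add_sub_cancel_left, add_sub_cancel_right] at this
      push_cast at this
      linear_combination this)
  have hp {n : ℤ} (hn : n ≠ 0) : basis.coord (Idx.L n) (E (I n)) = 0 :=
    eq_zero_of_weighted_shift_eq (p := fun n => basis.coord (Idx.L n) (E (I n)))
      (fun n m hnm => by
        have := hLI n m hnm (Idx.L (n + m))
        simp only [coord_L_lie_L, coord_L_lie_I, add_sub_cancel_left] at this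
        push_cast at this
        linear_combination this) hn
  have hq {n : ℤ} (hn : n ≠ 0) :
      basis.coord (Idx.I n) (E (I n)) = basis.coord (Idx.I 1) (E (I 1)) := by
    have := hLI (n - 1) 1 (by omega) (Idx.I n)
    simp [coord_I_lie_L, coord_I_lie_I, hf] at this
    exact this
  refine ⟨u, basis.coord (Idx.I 1) (E (L 1)) - basis.coord (Idx.I 0) (E (L 0)),
    basis.coord (Idx.I 0) (E (L 0)), basis.coord (Idx.I 1) (E (I 1)), fun n hn => ⟨?_, ?_⟩⟩
  · rw [← hE', apply_L_of_ne_zero hE hn, hf, zero_smul, zero_add, hg]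
  · rw [← hE', apply_I_of_ne_zero hE hn, hp hn, hq hn, zero_smul, zero_add]

section Diagonal

variable {E : LieDerivation ℂ HV HV} {a b q : ℂ}

theorem apply_L_zero_of_diagonal (h : ∀ n : ℤ, n ≠ 0 → E (L n) = (a * n + b) • I n) :
    E (L 0) = b • I 0 + (b - a) • CLI := by
  have := E.apply_lie_eq_sub (L 1) (L (-1))
  rw [h 1 (by norm_num), h (-1) (by norm_num)] at this
  norm_num [lie_L_L, lie_L_I, delta] at this
  linear_combination (norm := module) (2⁻¹ : ℂ) • this

theorem apply_CL_of_diagonal (h : ∀ n : ℤ, n ≠ 0 → E (L n) = (a * n + b) • I n) :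
    E CL = (-24 * a) • CLI := by
  have := E.apply_lie_eq_sub (L 2) (L (-2))
  rw [h 2 (by norm_num), h (-2) (by norm_num)] at this
  norm_num [lie_L_L, lie_L_I, delta, apply_L_zero_of_diagonal h] at this
  linear_combination (norm := module) (2 : ℂ) • this

theorem apply_CI_of_diagonal (h : ∀ n : ℤ, n ≠ 0 → E (I n) = q • I n) :
    E CI = (2 * q) • CI := by
  have := E.apply_lie_eq_sub (I 1) (I (-1))
  rw [h 1 (by norm_num), h (-1) (by norm_num)] at this
  norm_num [lie_I_I, delta] at this
  rw [this]
  module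

/-- The elements of nonzero degree generate the algebra: `⁅L (-1), I 1⁆ = -I 0` and `⁅L 1, I (-1)⁆ =
I 0 + 2 • CLI`. -/
theorem eq_zero_of_apply_eq_zero (hL : ∀ n : ℤ, n ≠ 0 → E (L n) = 0)
    (hI : ∀ n : ℤ, n ≠ 0 → E (I n) = 0) : E = 0 := by
  have hL' : ∀ n : ℤ, n ≠ 0 → E (L n) = ((0 : ℂ) * n + 0) • I n := by simpa using hL
  have hI' : ∀ n : ℤ, n ≠ 0 → E (I n) = (0 : ℂ) • I n := by simpa using hI
  have hI0 : E (I 0) = 0 := by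
    have := E.apply_lie_eq_sub (L (-1)) (I 1)
    rw [hL _ (by norm_num), hI _ (by norm_num)] at this
    norm_num [lie_L_I, delta] at this
    exact this
  have hCLI : E CLI = 0 := by
    have := E.apply_lie_eq_sub (L 1) (I (-1))
    rw [hL _ (by norm_num), hI _ (by norm_num)] at this
    norm_num [lie_L_I, delta, hI0] at this
    exact this
  have : (E : HV →ₗ[ℂ] HV) = 0 := by
    apply hom_ext
    · intro n
      rcases eq_or_ne n 0 with rfl | hn
      · simpa using apply_L_zero_of_diagonal hL'
      · exact hL n hn
    · intro n
      rcases eq_or_ne n 0 with rfl | hn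
      exacts [hI0, hI n hn]
    · simpa using apply_CL_of_diagonal hL'
    · exact hCLI
    · simpa using apply_CI_of_diagonal hI'
  exact LieDerivation.ext fun x => LinearMap.congr_fun this x

end Diagonal

/-! ### Derivations killing a marked element. -/

/-- The element `L_k + C_L + C_I`, whose annihilators among the derivations are the multiples of
`ad L_k`. -/
noncomputable def marked (k : ℤ) : HV := L k + CL + CI

@[simp]
theorem marked_lie (k : ℤ) (x : HV) : ⁅marked k, x⁆ = ⁅L k, x⁆ := by simp [marked]

theorem lie_I_zero (x : HV) : ⁅x, I 0⁆ = 0 := by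
  have : LieAlgebra.ad ℂ HV (I 0) = 0 := by
    apply hom_ext <;> simp +contextual [lie_I_L, lie_I_I, delta]
  rw [← lie_skew, neg_eq_zero]
  exact LinearMap.congr_fun this x

/-- With `E = D + inner u` in normal form, compare coordinates in `E (marked k) = ⁅L k, u⁆`. This
forces `a = b = q = 0`, so `E = 0`, and leaves `u` in `ℂ L k` plus the centre, which contains `I 0`.
-/
theorem exists_eq_smul_lie_of_apply_marked {D : LieDerivation ℂ HV HV} {k : ℤ}
    (hD : D (marked k) = 0) : ∃ c : ℂ, ∀ x, D x = c • ⁅L k, x⁆ := by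
  obtain ⟨u, a, b, q, h⟩ := exists_inner_apply_eq D
  obtain ⟨E, hE⟩ : ∃ E, E = D + LieDerivation.inner ℂ HV HV u := ⟨_, rfl⟩
  rw [← hE] at h
  have hL n hn := (h n hn).1
  have hI n hn := (h n hn).2
  have hk (i : Idx) : basis.coord i (E (L k)) + basis.coord i (E CL) + basis.coord i (E CI) =
      basis.coord i ⁅L k, u⁆ := by
    have : E (marked k) = ⁅L k, u⁆ := by simp [hE, hD]
    rw [← this]
    simp [marked]
  rw [apply_CL_of_diagonal hL, apply_CI_of_diagonal hI] at hk
  have hq : q = 0 := by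
    rcases eq_or_ne k 0 with rfl | hk0
    · simpa [apply_L_zero_of_diagonal hL, coord_CI_lie_L] using hk Idx.CI
    · simpa [hL k hk0, coord_CI_lie_L] using hk Idx.CI
  have huI {j : ℤ} (hj : j ≠ 0) : basis.coord (Idx.I j) u = 0 := by
    have := hk (Idx.I (k + j))
    rcases eq_or_ne k 0 with rfl | hk0
    · simpa [apply_L_zero_of_diagonal hL, coord_I_lie_L, hj, hj.symm] using this
    · simpa [hL k hk0, coord_I_lie_L, hj] using this
  have huL {j : ℤ} (hj : j ≠ k) : basis.coord (Idx.L j) u = 0 := by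
    have hj' : (2 * k - (k + j) : ℂ) ≠ 0 := by
      exact_mod_cast (by omega : (2 * k - (k + j) : ℤ) ≠ 0)
    have := hk (Idx.L (k + j))
    rcases eq_or_ne k 0 with rfl | hk0
    · simpa [apply_L_zero_of_diagonal hL, coord_L_lie_L, hj] using this
    · simpa [hL k hk0, coord_L_lie_L, hj'] using this
  have hab : a = 0 ∧ b = 0 := by
    have h1 := hk (Idx.I k)
    have h2 := hk Idx.CLI
    rcases eq_or_ne k 0 with rfl | hk0
    · simp [apply_L_zero_of_diagonal hL, coord_I_lie_L, coord_CLI_lie_L] at h1 h2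
      refine ⟨?_, h1⟩
      -- The `CLI` coordinate is `(b - a) - 24 * a`, from `E (L 0)` and `E CL`.
      linear_combination (h1 - h2) / 25
    · simp [hL k hk0, coord_I_lie_L, coord_CLI_lie_L, huI (neg_ne_zero.2 hk0)] at h1 h2
      exact ⟨h2, by simpa [h2] using h1⟩
  obtain ⟨rfl, rfl⟩ := hab
  subst hq
  have hE0 : E = 0 := eq_zero_of_apply_eq_zero (by simpa using hL) (by simpa using hI)
  have hu : u = basis.coord (Idx.L k) u • L k + basis.coord (Idx.I 0) u • I 0 +
      basis.coord Idx.CL u • CL + basis.coord Idx.CLI u • CLI + basis.coord Idx.CI u • CI := by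
    refine ext_coord fun i => ?_
    cases i with
    | L j =>
      rcases eq_or_ne k j with rfl | hj
      · simp
      · simp [hj, huL hj.symm]
    | I j =>
      rcases eq_or_ne 0 j with rfl | hj
      · simp
      · simp [hj, huI hj.symm]
    | _ => simp
  refine ⟨basis.coord (Idx.L k) u, fun x => ?_⟩
  have hx : D x + ⁅x, u⁆ = 0 := by simpa [hE] using congrArg (fun F => F x) hE0
  rw [eq_neg_of_add_eq_zero_left hx]
  nth_rewrite 1 [hu]
  simp only [lie_add, lie_smul, lie_I_zero, lie_CL, lie_CLI, lie_CI, smul_zero, add_zero]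
  rw [← lie_skew x (L k), smul_neg, neg_neg]

/-! ### Vanishing by disjoint supports. -/

theorem finite_setOf_coord_ne_zero (x : HV) :
    {n : ℤ | basis.coord (Idx.L n) x ≠ 0 ∨ basis.coord (Idx.I n) x ≠ 0}.Finite := by
  have hfin := (basis.repr x).hasFiniteSupport
  exact (hfin.preimage (f := Idx.L) fun _ _ _ _ h => Idx.L.inj h).union
    (hfin.preimage (f := Idx.I) fun _ _ _ _ h => Idx.I.inj h)

theorem eq_zero_of_forall_exists_smul_lie {x y : HV} (h : ∀ k : ℤ, ∃ c : ℂ, y = c • ⁅L k, x⁆) :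
    y = 0 := by
  have hfin := finite_setOf_coord_ne_zero x
  set S := {n : ℤ | basis.coord (Idx.L n) x ≠ 0 ∨ basis.coord (Idx.I n) x ≠ 0} with hS
  -- For `k` outside the finite set `S - S`, the translate `S + k` is disjoint from `S`. The
  -- multiple of `⁅L k, x⁆` then vanishes in degrees in `S`, and that of `⁅L 0, x⁆` elsewhere and on
  -- the central coordinates.
  obtain ⟨k, hk⟩ := (hfin.image2 (· - ·) hfin).exists_notMem
  have hSk {n : ℤ} (hn : n ∈ S) :
      basis.coord (Idx.L (n - k)) x = 0 ∧ basis.coord (Idx.I (n - k)) x = 0 := by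
    by_contra hcon
    refine hk ⟨n, hn, n - k, ?_, by simp⟩
    rw [hS, Set.mem_ofPred_eq]
    tauto
  obtain ⟨c, hc⟩ := h 0
  obtain ⟨d, hd⟩ := h k
  refine ext_coord fun i => ?_
  cases i with
  | L n =>
    by_cases hn : n ∈ S
    · simp [hd, coord_L_lie_L, (hSk hn).1]
    · simp [hS] at hn
      simp [hc, coord_L_lie_L, hn.1]
  | I n =>
    by_cases hn : n ∈ S
    · simp [hd, coord_I_lie_L, (hSk hn).2]
    · simp [hS] at hn
      simp [hc, coord_I_lie_L, hn.2]
  | _ => simp [hc, coord_CL_lie_L, coord_CLI_lie_L, coord_CI_lie_L]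

theorem IsTwoLocalDerivation.eq_zero_of_marked {Δ : HV → HV} (hΔ : IsTwoLocalDerivation ℂ Δ)
    (h0 : Δ (marked 0) = 0) (h1 : Δ (marked 1) = 0) (x : HV) : Δ x = 0 := by
  have key {k : ℤ} (hk : Δ (marked k) = 0) (x : HV) : ∃ c : ℂ, Δ x = c • ⁅L k, x⁆ := by
    obtain ⟨D, hD, hDx⟩ := hΔ (marked k) x
    obtain ⟨c, hc⟩ := exists_eq_smul_lie_of_apply_marked (hD.trans hk)
    exact ⟨c, by rw [← hDx, hc]⟩
  refine eq_zero_of_forall_exists_smul_lie fun k => key ?_ x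
  obtain ⟨c, hc⟩ := key h0 (marked k)
  obtain ⟨d, hd⟩ := key h1 (marked k)
  -- `⁅L 0, L k⁆ = -k • L k`, whereas `⁅L 1, L k⁆` has no `L k` coordinate.
  have := congrArg (basis.coord (Idx.L k)) (hc.symm.trans hd)
  rcases eq_or_ne k 0 with rfl | hk
  · exact h0
  · have hc0 : c = 0 := by
      simpa [marked, coord_L_lie_L, hk, show k ≠ k - 1 by omega] using this
    rw [hc, hc0, zero_smul]

end TwistedHeisenbergVirasoro

theorem mainTheorem1 (Δ : TwistedHeisenbergVirasoro.HV → TwistedHeisenbergVirasoro.HV)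
    (hΔ : TwistedHeisenbergVirasoro.IsTwoLocalDerivation ℂ Δ) :
    ∃ D : LieDerivation ℂ TwistedHeisenbergVirasoro.HV TwistedHeisenbergVirasoro.HV,
      ∀ x, D x = Δ x := by
  obtain ⟨D, h0, h1⟩ := hΔ (TwistedHeisenbergVirasoro.marked 0) (TwistedHeisenbergVirasoro.marked 1)
  have hsub : TwistedHeisenbergVirasoro.IsTwoLocalDerivation ℂ fun x => Δ x - D x := by
    intro x y
    obtain ⟨F, hx, hy⟩ := hΔ x y
    exact ⟨F - D, by simp [hx], by simp [hy]⟩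
  exact ⟨D, fun x => (sub_eq_zero.1
    (hsub.eq_zero_of_marked (sub_eq_zero.2 h0.symm) (sub_eq_zero.2 h1.symm) x)).symm⟩
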